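/- Let $H$ be a complex Hilbert space and let $M\subseteq B(H)$ be a von Neumann algebra (a self-adjoint, weakly closed algebra of bounded operators on $H$ containing the identity operator $I$; equivalently, a $*$-subalgebra of $B(H)$ that equals its double commutant). Assume that $M$ is a factor, i.e. its center consists only of the scalar operators $\lambda I$, $\lambda\in\mathbb{C}$, and that $\dim_{\mathbb{C}} M\ge 2$. For $A,B\in M$ put $$[A,B]_*=AB-BA^*,\qquad A\bullet B=AB+BA^*.$$ Let $\Phi:M\to M$ be an arbitrary map (not assumed to be additive, linear or continuous). Then $\Phi$ is a nonlinear mixed Jordan triple $*$-derivation, i.e. $$\Phi([A\bullet B,C]_*)=[\Phi(A)\bullet B,C]_*+[A\bullet\Phi(B),C]_*+[A\bullet B,\Phi(C)]_*\quad\text{for all }A,B,C\in M,$$ if and only if $\Phi$ is an additive $*$-derivation, i.e. for all $A,B\in M$ $$\Phi(A+B)=\Phi(A)+\Phi(B),\qquad \Phi(AB)=\Phi(A)B+A\Phi(B),\qquad \Phi(A^*)=\Phi(A)^*.$$ -/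

import Mathlib

/-- The skew Lie product `[A, B]_* = A B - B A*`. -/
def skewLieProduct {𝒜 : Type*} [NonUnitalRing 𝒜] [StarRing 𝒜] (A B : 𝒜) : 𝒜 :=
  A * B - B * star A

/-- The Jordan `*`-product `A • B = A B + B A*`. -/
def jordanStarProduct {𝒜 : Type*} [NonUnitalRing 𝒜] [StarRing 𝒜] (A B : 𝒜) : 𝒜 :=
  A * B + B * star A

/-- A (not necessarily additive or linear) map `Φ` is a nonlinear mixed Jordan triple
`*`-derivation if
`Φ([A • B, C]_*) = [Φ(A) • B, C]_* + [A • Φ(B), C]_* + [A • B, Φ(C)]_*` for all `A, B, C`. -/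
def IsMixedJordanTripleStarDerivation {𝒜 : Type*} [NonUnitalRing 𝒜] [StarRing 𝒜]
    (Φ : 𝒜 → 𝒜) : Prop :=
  ∀ A B C : 𝒜,
    Φ (skewLieProduct (jordanStarProduct A B) C) =
      skewLieProduct (jordanStarProduct (Φ A) B) C +
      skewLieProduct (jordanStarProduct A (Φ B)) C +
      skewLieProduct (jordanStarProduct A B) (Φ C)

/-- An additive `*`-derivation: an additive map satisfying the Leibniz rule and commuting with
the involution. -/
structure IsAdditiveStarDerivation {𝒜 : Type*} [NonUnitalRing 𝒜] [StarRing 𝒜]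
    (Φ : 𝒜 → 𝒜) : Prop where
  map_add : ∀ A B : 𝒜, Φ (A + B) = Φ A + Φ B
  map_mul : ∀ A B : 𝒜, Φ (A * B) = Φ A * B + A * Φ B
  map_star : ∀ A : 𝒜, Φ (star A) = star (Φ A)

/-- A von Neumann algebra is a factor if its center consists of the scalar operators only. -/
def VonNeumannAlgebra.IsFactor {H : Type*} [NormedAddCommGroup H] [InnerProductSpace ℂ H]
    [CompleteSpace H] (M : VonNeumannAlgebra H) : Prop :=
  Subalgebra.center ℂ M.toStarSubalgebra = ⊥

/-! A derivation respects sums, products and stars, so one direction is expansion. For the converse,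
the first task is additivity. The triple product is additive in each slot, so every map `L` obtained
by fixing two slots carries the defect Φ(A+B) − Φ(A) − Φ(B) to the defect of (L A, L B), which
vanishes once L A = 0 or L B = 0. Relative to a nontrivial projection P, suitable `L` detect all
four Peirce components; this gives additivity across different components, then inside an
off-diagonal one, and finally inside a diagonal one by primeness.

Given additivity, testing on 1 and on J = i·1 forces Φ(1) = Φ(J) = 0 and Φ(JC) = JΦ(C). The triple
rule then becomes a Leibniz rule for [X, C]_*; replacing X by JX gives one for X • C, and the two
add up to the rule for XC.

The von Neumann hypotheses enter only through a nontrivial projection, which exists because dim M ≥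
2, and primeness, which holds because M is a factor. -/

section Algebra

variable {𝒜 : Type*} [Ring 𝒜] [StarRing 𝒜] {Φ : 𝒜 → 𝒜}

/-- Every additive `*`-derivation is a mixed Jordan triple `*`-derivation. -/
theorem IsAdditiveStarDerivation.isMixedJordanTripleStarDerivation
    (h : IsAdditiveStarDerivation Φ) : IsMixedJordanTripleStarDerivation Φ := by
  intro A B C
  have hneg : ∀ X, Φ (-X) = -Φ X := fun X => by
    have h0 : Φ 0 = 0 := by simpa using h.map_add 0 0
    have := h.map_add (-X) X
    rw [neg_add_cancel, h0] at this
    exact eq_neg_of_add_eq_zero_left this.symm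
  simp only [skewLieProduct, jordanStarProduct, sub_eq_add_neg, h.map_add, hneg, h.map_mul,
    h.map_star, star_add, star_mul, star_star]
  noncomm_ring

/-! ### The additive defect and the maps that transport it. -/

/-- The failure of additivity of a map. -/
def additiveDefect (Φ : 𝒜 → 𝒜) (A B : 𝒜) : 𝒜 := Φ (A + B) - Φ A - Φ B

/-- `L` intertwines the additive defect of `Φ`. -/
def DefectCompatible (Φ L : 𝒜 → 𝒜) : Prop :=
  ∀ A B, L (additiveDefect Φ A B) = additiveDefect Φ (L A) (L B)

omit [StarRing 𝒜] in
theorem DefectCompatible.comp {L L' : 𝒜 → 𝒜} (h : DefectCompatible Φ L)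
    (h' : DefectCompatible Φ L') : DefectCompatible Φ (fun C => L (L' C)) := fun A B => by
  simp only [h' A B, h (L' A) (L' B)]

namespace IsMixedJordanTripleStarDerivation

theorem map_zero (h : IsMixedJordanTripleStarDerivation Φ) : Φ 0 = 0 := by
  simpa [skewLieProduct, jordanStarProduct] using h 0 0 0

theorem additiveDefect_zero_left (h : IsMixedJordanTripleStarDerivation Φ) (A : 𝒜) :
    additiveDefect Φ 0 A = 0 := by simp [additiveDefect, h.map_zero]

theorem additiveDefect_zero_right (h : IsMixedJordanTripleStarDerivation Φ) (A : 𝒜) :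
    additiveDefect Φ A 0 = 0 := by simp [additiveDefect, h.map_zero]

/-- Expanding Φ at the images of A + B, A and B, the terms with Φ on a fixed slot cancel by
additivity of the product; what survives is the defect in the varying slot. The other two slots work
alike. -/
theorem defectCompatible_first (h : IsMixedJordanTripleStarDerivation Φ) (Y Z : 𝒜) :
    DefectCompatible Φ (fun C => skewLieProduct (jordanStarProduct C Y) Z) := fun A B => by
  have e : skewLieProduct (jordanStarProduct A Y) Z + skewLieProduct (jordanStarProduct B Y) Z
      = skewLieProduct (jordanStarProduct (A + B) Y) Z := by
    simp only [skewLieProduct, jordanStarProduct, star_add, star_mul, star_star]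
    noncomm_ring
  simp only [additiveDefect, e, h _ _ _]
  simp only [skewLieProduct, jordanStarProduct, star_add, star_sub, star_mul, star_star]
  noncomm_ring

theorem defectCompatible_second (h : IsMixedJordanTripleStarDerivation Φ) (Y Z : 𝒜) :
    DefectCompatible Φ (fun C => skewLieProduct (jordanStarProduct Y C) Z) := fun A B => by
  have e : skewLieProduct (jordanStarProduct Y A) Z + skewLieProduct (jordanStarProduct Y B) Z
      = skewLieProduct (jordanStarProduct Y (A + B)) Z := by
    simp only [skewLieProduct, jordanStarProduct, star_add, star_mul, star_star]
    noncomm_ring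
  simp only [additiveDefect, e, h _ _ _]
  simp only [skewLieProduct, jordanStarProduct, star_add, star_sub, star_mul, star_star]
  noncomm_ring

theorem defectCompatible_third (h : IsMixedJordanTripleStarDerivation Φ) (Y Z : 𝒜) :
    DefectCompatible Φ (fun C => skewLieProduct (jordanStarProduct Y Z) C) := fun A B => by
  have e : skewLieProduct (jordanStarProduct Y Z) A + skewLieProduct (jordanStarProduct Y Z) B
      = skewLieProduct (jordanStarProduct Y Z) (A + B) := by
    simp only [skewLieProduct]
    noncomm_ring
  simp only [additiveDefect, e, h _ _ _]
  simp only [skewLieProduct, jordanStarProduct, star_add, star_mul, star_star]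
  noncomm_ring

/-! ### Additivity through the Peirce decomposition. -/

variable [Algebra ℂ 𝒜] [StarModule ℂ 𝒜]

/-- Putting 1/2 in the first slot collapses the triple product to the binary [A, B]_*. -/
theorem _root_.jordanStarProduct_half (A : 𝒜) :
    jordanStarProduct ((2⁻¹ : ℂ) • (1 : 𝒜)) A = A := by
  have : star (2⁻¹ : ℂ) = 2⁻¹ := by simp
  simp only [jordanStarProduct, star_smul, this, star_one, smul_mul_assoc, one_mul,
    mul_smul_comm, mul_one, ← add_smul]
  norm_num

theorem defectCompatible_skew_right (h : IsMixedJordanTripleStarDerivation Φ) (X : 𝒜) :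
    DefectCompatible Φ (fun C => skewLieProduct X C) := by
  simpa only [jordanStarProduct_half] using h.defectCompatible_third ((2⁻¹ : ℂ) • (1 : 𝒜)) X

theorem defectCompatible_skew_left (h : IsMixedJordanTripleStarDerivation Φ) (X : 𝒜) :
    DefectCompatible Φ (fun C => skewLieProduct C X) := by
  simpa only [jordanStarProduct_half] using h.defectCompatible_second ((2⁻¹ : ℂ) • (1 : 𝒜)) X

theorem defectCompatible_corner (h : IsMixedJordanTripleStarDerivation Φ) {P : 𝒜}
    (hP : IsStarProjection P) : DefectCompatible Φ (fun C => P * C * P) := by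
  -- For self-adjoint T, [iT, C]_* = i(TC + CT), so imaginary multiples give anticommutators. Those
  -- with P and then 2P − 1 compose to 4PCP; the factors −i/2 and i/2 multiply to 1/4.
  convert (h.defectCompatible_skew_right ((Complex.I / 2) • (P + P - 1))).comp
    (h.defectCompatible_skew_right ((-Complex.I / 2) • P)) using 2 with C
  have hPP : P * P = P := hP.isIdempotentElem
  have hPP' : ∀ X, P * (P * X) = P * X := fun X => by rw [← mul_assoc, hPP]
  have hs : star P = P := hP.isSelfAdjoint
  simp only [skewLieProduct, star_smul, star_sub, star_add, hs, star_one, star_div₀, star_neg,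
    Complex.star_def, Complex.conj_I, map_ofNat, smul_mul_assoc, mul_smul_comm, mul_add, mul_sub,
    add_mul, sub_mul, mul_assoc, hPP, hPP', smul_sub, smul_add, smul_smul, one_mul, mul_one]
  match_scalars <;> ring_nf
  simp

/-- Each Peirce component of the defect is detected by a compatible map that annihilates A or B,
hence is zero. -/
theorem additiveDefect_eq_zero_of_peirce (h : IsMixedJordanTripleStarDerivation Φ) {P : 𝒜}
    (hP : IsStarProjection P) {A B : 𝒜}
    (h₁₁ : P * A * P = 0 ∨ P * B * P = 0)
    (h₁₂ : P * A * (1 - P) = 0 ∨ P * B * (1 - P) = 0)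
    (h₂₁ : (1 - P) * A * P = 0 ∨ (1 - P) * B * P = 0)
    (h₂₂ : (1 - P) * A * (1 - P) = 0 ∨ (1 - P) * B * (1 - P) = 0) :
    additiveDefect Φ A B = 0 := by
  have key {L : 𝒜 → 𝒜} (hL : DefectCompatible Φ L) (h0 : L A = 0 ∨ L B = 0) :
      L (additiveDefect Φ A B) = 0 := by
    rcases h0 with h0 | h0
    · rw [hL, h0, h.additiveDefect_zero_left]
    · rw [hL, h0, h.additiveDefect_zero_right]
  have off {R : 𝒜} (hR : IsStarProjection R)
      (h0 : (1 - R) * A * R = 0 ∨ (1 - R) * B * R = 0) :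
      (1 - R) * additiveDefect Φ A B * R = 0 := by
    have hform (C : 𝒜) : skewLieProduct (jordanStarProduct C R) (1 - R) =
        R * star C * (1 - R) - (1 - R) * C * R := by
      have hs : star R = R := hR.isSelfAdjoint
      simp only [skewLieProduct, jordanStarProduct, star_add, star_mul, star_star, hs]
      have h1 : R * (1 - R) = 0 := hR.mul_one_sub_self
      have h2 : (1 - R) * R = 0 := hR.one_sub_mul_self
      rw [add_mul, mul_add, mul_assoc C, h1, mul_zero, zero_add, ← mul_assoc (1 - R) R, h2,
        zero_mul, zero_add, mul_assoc (1 - R)]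
    have hz {C : 𝒜} (hC : (1 - R) * C * R = 0) : R * star C * (1 - R) = 0 := by
      simpa [mul_assoc, hR.isSelfAdjoint.star_eq] using congrArg star hC
    have e := key (h.defectCompatible_first R (1 - R)) (by
      simp only [hform]
      exact h0.imp (fun h0 => by rw [hz h0, h0, sub_zero]) (fun h0 => by rw [hz h0, h0, sub_zero]))
    simp only [hform] at e
    -- The star in the first slot produces two terms in opposite corners; left multiplication by 1 −
    -- R keeps only one.
    have e' := congrArg (fun X => (1 - R) * X) e
    have h2 : (1 - R) * R = 0 := hR.one_sub_mul_self
    have h3 : (1 - R) * (1 - R) = 1 - R := hR.one_sub.isIdempotentElem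
    simpa only [mul_sub (1 - R) (R * _ * _), ← mul_assoc, h2, h3, zero_mul, zero_sub, mul_zero,
      neg_eq_zero] using e'
  have e₁₁ := key (h.defectCompatible_corner hP) h₁₁
  have e₂₂ := key (h.defectCompatible_corner hP.one_sub) h₂₂
  have e₂₁ := off hP h₂₁
  have e₁₂ := off hP.one_sub (by simpa using h₁₂)
  simp only [sub_sub_cancel] at e₁₂ e₁₁ e₂₂
  have : ∀ X : 𝒜, X = P * X * P + (1 - P) * X * (1 - P) + P * X * (1 - P) + (1 - P) * X * P :=
    fun X => by noncomm_ring
  rw [this (additiveDefect Φ A B), e₁₁, e₂₂, e₂₁, e₁₂]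
  simp

theorem map_add_of_peirce (h : IsMixedJordanTripleStarDerivation Φ) {P : 𝒜}
    (hP : IsStarProjection P) {A B : 𝒜}
    (h₁₁ : P * A * P = 0 ∨ P * B * P = 0)
    (h₁₂ : P * A * (1 - P) = 0 ∨ P * B * (1 - P) = 0)
    (h₂₁ : (1 - P) * A * P = 0 ∨ (1 - P) * B * P = 0)
    (h₂₂ : (1 - P) * A * (1 - P) = 0 ∨ (1 - P) * B * (1 - P) = 0) :
    Φ (A + B) = Φ A + Φ B := by
  have := h.additiveDefect_eq_zero_of_peirce hP h₁₁ h₁₂ h₂₁ h₂₂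
  rwa [additiveDefect, sub_sub, sub_eq_zero] at this

theorem map_skewLieProduct_add_add (h : IsMixedJordanTripleStarDerivation Φ) {X X' Y Y' : 𝒜}
    (hX : Φ (X + X') = Φ X + Φ X') (hY : Φ (Y + Y') = Φ Y + Φ Y') :
    Φ (skewLieProduct (X + X') (Y + Y')) =
      Φ (skewLieProduct X Y) + Φ (skewLieProduct X Y') +
      Φ (skewLieProduct X' Y) + Φ (skewLieProduct X' Y') := by
  have e := h ((2⁻¹ : ℂ) • (1 : 𝒜))
  simp only [jordanStarProduct_half] at e
  simp only [e, hX, hY]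
  simp only [skewLieProduct, jordanStarProduct, star_add, star_mul, star_star]
  noncomm_ring

/-- The sum a + b is the P, 1 − P component of [P + a, (1 − P) + b]_*; the remaining terms −a* and
−ba* lie in other components, so additivity across components lets them cancel. -/
theorem map_add_offDiagonal (h : IsMixedJordanTripleStarDerivation Φ) {P : 𝒜}
    (hP : IsStarProjection P) {a b : 𝒜} (ha : P * a = a) (ha' : a * P = 0)
    (hb : P * b = b) (hb' : b * P = 0) : Φ (a + b) = Φ a + Φ b := by
  have hPP : P * P = P := hP.isIdempotentElem
  have hs : star P = P := hP.isSelfAdjoint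
  obtain ⟨s, hs'⟩ : ∃ s, star a = s := ⟨_, rfl⟩
  have sP : s * P = s := by rw [← hs', ← hs, ← star_mul, ha]
  have Ps : P * s = 0 := by rw [← hs', ← hs, ← star_mul, ha', star_zero]
  obtain ⟨z, hz⟩ : ∃ z, b * s = z := ⟨_, rfl⟩
  have Pz : P * z = z := by rw [← hz, ← mul_assoc, hb]
  have zP : z * P = z := by rw [← hz, mul_assoc, sP]
  have aa : a * b = 0 := by rw [← hb, ← mul_assoc, ha', zero_mul]
  have hX : Φ (P + a) = Φ P + Φ a := h.map_add_of_peirce hP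
    (by simp [mul_assoc, ha, ha']) (by simp [mul_sub, mul_assoc, hPP])
    (by simp [sub_mul, mul_assoc, hPP]) (by simp [sub_mul, mul_assoc, hPP])
  have hY : Φ (1 - P + b) = Φ (1 - P) + Φ b := h.map_add_of_peirce hP
    (by simp [mul_sub, hPP]) (by simp [mul_sub, hPP])
    (by simp [mul_assoc, sub_mul, hPP]) (by simp [sub_mul, hb])
  have key := h.map_skewLieProduct_add_add hX hY
  have e₀ : skewLieProduct (P + a) (1 - P + b) = (a + b) + (-s + -z) := by
    simp only [skewLieProduct, star_add, hs, hs', mul_add, add_mul, sub_mul, mul_sub, hPP, ha',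
      hb, hb', aa, Ps, hz, mul_one, one_mul]
    abel
  have e₁ : skewLieProduct P (1 - P) = 0 := by simp [skewLieProduct, hs, mul_sub, sub_mul, hPP]
  have e₂ : skewLieProduct P b = b := by simp [skewLieProduct, hs, hb, hb']
  have e₃ : skewLieProduct a (1 - P) = a + -s := by
    simp [skewLieProduct, hs', mul_sub, sub_mul, ha', Ps, ← sub_eq_add_neg]
  have e₄ : skewLieProduct a b = -z := by simp [skewLieProduct, hs', aa, hz]
  have f₁ : Φ ((a + b) + (-s + -z)) = Φ (a + b) + Φ (-s + -z) := h.map_add_of_peirce hP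
    (by simp [mul_add, add_mul, mul_assoc, ha', hb'])
    (by right; simp [mul_add, mul_sub, Ps, zP, Pz])
    (by left; simp [mul_add, sub_mul, ha, hb])
    (by left; simp [mul_add, sub_mul, ha, hb])
  have f₂ : Φ (-s + -z) = Φ (-s) + Φ (-z) := h.map_add_of_peirce hP
    (by simp [Ps]) (by simp [Ps]) (by right; simp [sub_mul, Pz]) (by right; simp [sub_mul, Pz])
  have f₃ : Φ (a + -s) = Φ a + Φ (-s) := h.map_add_of_peirce hP
    (by simp [Ps]) (by simp [Ps]) (by left; simp [sub_mul, ha]) (by left; simp [sub_mul, ha])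
  rw [e₀, e₁, e₂, e₃, e₄, f₁, f₂, f₃, h.map_zero] at key
  have : Φ (a + b) + (Φ (-s) + Φ (-z)) = (Φ a + Φ b) + (Φ (-s) + Φ (-z)) := by
    rw [key]; abel
  exact add_right_cancel this

/-- Multiplying the defect by PC(1 − P) turns it into an off-diagonal defect, already known to
vanish; the annihilator condition then removes the factor. -/
theorem map_add_corner (h : IsMixedJordanTripleStarDerivation Φ) {P : 𝒜}
    (hP : IsStarProjection P) (hQ : ∀ X : 𝒜, (∀ A, X * A * (1 - P) = 0) → X = 0) (A B : 𝒜) :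
    Φ (P * A * P + P * B * P) = Φ (P * A * P) + Φ (P * B * P) := by
  have hPP : P * P = P := hP.isIdempotentElem
  have hPP' : ∀ X, P * (P * X) = P * X := fun X => by rw [← mul_assoc, hPP]
  have hs : star P = P := hP.isSelfAdjoint
  obtain ⟨D, hD⟩ : ∃ D, additiveDefect Φ (P * A * P) (P * B * P) = D := ⟨_, rfl⟩
  have hPD : P * D * P = D := by
    have := h.defectCompatible_corner hP (P * A * P) (P * B * P)
    simp only [mul_assoc, hPP, hPP'] at this hD ⊢
    rw [hD] at this
    exact this
  have hD0 : D = 0 := hQ D fun C => by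
    have e := h.defectCompatible_skew_left (P * C * (1 - P)) (P * A * P) (P * B * P)
    have hQP : (1 - P) * P = 0 := hP.one_sub_mul_self
    have hQP' : ∀ X, (1 - P) * (P * X) = 0 := fun X => by rw [← mul_assoc, hQP, zero_mul]
    have hf : ∀ X, skewLieProduct (P * X * P) (P * C * (1 - P)) = P * X * P * C * (1 - P) :=
      fun X => by simp only [skewLieProduct, star_mul, hs, mul_assoc, hPP', hQP', mul_zero,
        sub_zero]
    simp only [hD] at e
    rw [← hPD] at e
    simp only [hf] at e
    rw [hPD] at e
    rw [e, additiveDefect, h.map_add_offDiagonal hP]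
    · abel
    all_goals simp only [mul_assoc, hPP', hQP, mul_zero]
  rwa [← hD, additiveDefect, sub_sub, sub_eq_zero] at hD0

theorem map_peirce (h : IsMixedJordanTripleStarDerivation Φ) {P : 𝒜}
    (hP : IsStarProjection P) (A : 𝒜) :
    Φ A = Φ (P * A * P) + Φ (P * A * (1 - P)) + Φ ((1 - P) * A * P)
      + Φ ((1 - P) * A * (1 - P)) := by
  have h12 : P * (1 - P) = 0 := hP.mul_one_sub_self
  have h21 : (1 - P) * P = 0 := hP.one_sub_mul_self
  have h12' : ∀ X, P * ((1 - P) * X) = 0 := fun X => by rw [← mul_assoc, h12, zero_mul]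
  have h21' : ∀ X, (1 - P) * (P * X) = 0 := fun X => by rw [← mul_assoc, h21, zero_mul]
  have hA : A = P * A * P + P * A * (1 - P) + (1 - P) * A * P + (1 - P) * A * (1 - P) := by
    noncomm_ring
  conv_lhs => rw [hA]
  rw [h.map_add_of_peirce hP, h.map_add_of_peirce hP, h.map_add_of_peirce hP]
  all_goals simp only [mul_add, add_mul, mul_assoc, h12, h21, h12', h21', mul_zero, zero_mul, add_zero,
    true_or, or_true]

/-- If a `*`-algebra has a projection `P` such that `X 𝒜 P = 0` or `X 𝒜 (1 - P) = 0` only for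
`X = 0`, then its mixed Jordan triple `*`-derivations are additive. -/
theorem map_add (h : IsMixedJordanTripleStarDerivation Φ) {P : 𝒜} (hP : IsStarProjection P)
    (hP' : ∀ X : 𝒜, (∀ A, X * A * P = 0) → X = 0)
    (hQ : ∀ X : 𝒜, (∀ A, X * A * (1 - P) = 0) → X = 0) (A B : 𝒜) :
    Φ (A + B) = Φ A + Φ B := by
  have hPP : P * P = P := hP.isIdempotentElem
  have h12 : P * (1 - P) = 0 := hP.mul_one_sub_self
  have h21 : (1 - P) * P = 0 := hP.one_sub_mul_self
  have hPP' : ∀ X, P * (P * X) = P * X := fun X => by rw [← mul_assoc, hPP]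
  have hQQ' : ∀ X, (1 - P) * ((1 - P) * X) = (1 - P) * X := fun X => by
    rw [← mul_assoc, hP.one_sub.isIdempotentElem.eq]
  have e₂₂ := h.map_add_corner hP.one_sub (by simpa using hP') A B
  have e₁₂ := h.map_add_offDiagonal hP (a := P * A * (1 - P)) (b := P * B * (1 - P))
    (by simp only [mul_assoc, hPP']) (by rw [mul_assoc, h21, mul_zero])
    (by simp only [mul_assoc, hPP']) (by rw [mul_assoc, h21, mul_zero])
  have e₂₁ := h.map_add_offDiagonal hP.one_sub (a := (1 - P) * A * P) (b := (1 - P) * B * P)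
    (by simp only [mul_assoc, hQQ']) (by rw [mul_assoc, h12, mul_zero])
    (by simp only [mul_assoc, hQQ']) (by rw [mul_assoc, h12, mul_zero])
  rw [h.map_peirce hP (A + B), h.map_peirce hP A, h.map_peirce hP B]
  simp only [mul_add, add_mul, h.map_add_corner hP hQ A B, e₁₂, e₂₁, e₂₂]
  abel

/-! ### From additivity to the Leibniz rule. -/

/-- An additive mixed Jordan triple `*`-derivation is an additive `*`-derivation. -/
theorem isAdditiveStarDerivation_of_map_add (h : IsMixedJordanTripleStarDerivation Φ)
    (hadd : ∀ A B, Φ (A + B) = Φ A + Φ B) : IsAdditiveStarDerivation Φ := by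
  have hneg (X) : Φ (-X) = -Φ X := by
    have := hadd (-X) X
    rw [neg_add_cancel, h.map_zero] at this
    exact eq_neg_of_add_eq_zero_left this.symm
  have hsub (X Y) : Φ (X - Y) = Φ X - Φ Y := by rw [sub_eq_add_neg, hadd, hneg, sub_eq_add_neg]
  have two_cancel {X Y : 𝒜} (e : X + X = Y + Y) : X = Y := by
    have := congrArg (fun Z => (2⁻¹ : ℂ) • Z) e
    simpa only [← two_smul ℂ, smul_smul, inv_mul_cancel₀ (two_ne_zero' ℂ), one_smul] using this
  obtain ⟨J, hJ⟩ : ∃ J : 𝒜, Complex.I • (1 : 𝒜) = J := ⟨_, rfl⟩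
  have sJ : star J = -J := by simp [← hJ]
  have cJ (X : 𝒜) : X * J = J * X := by simp [← hJ]
  have JJ : J * J = -1 := by simp [← hJ, smul_smul]
  have JJ' (X : 𝒜) : J * (J * X) = -X := by rw [← mul_assoc, JJ, neg_one_mul]
  have cJ' (X Y : 𝒜) : X * (J * Y) = J * (X * Y) := by rw [← mul_assoc, cJ, mul_assoc]
  have J_inj {X : 𝒜} (e : J * X = 0) : X = 0 := by
    rw [← neg_eq_zero, ← JJ', e, mul_zero]
  -- `Φ J` is central and skew-adjoint.
  obtain ⟨S, hS⟩ : ∃ S, Φ J = S := ⟨_, rfl⟩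
  have hS₁ (B C : 𝒜) : skewLieProduct (jordanStarProduct S B) C = 0 := by
    have e := h J B C
    have e0 (B C : 𝒜) : skewLieProduct (jordanStarProduct J B) C = 0 := by
      simp [skewLieProduct, jordanStarProduct, sJ, cJ]
    rw [e0, e0, e0, h.map_zero, add_zero, add_zero, hS] at e
    exact e.symm
  -- With C = 1, S • B is self-adjoint for every B. So is S • (JB) = J(S • B), and since J is
  -- central and skew-adjoint, S • B = 0.
  have hS₂ (B : 𝒜) : S * B + B * star S = 0 := by
    have e₁ := hS₁ B 1
    have e₂ := hS₁ (J * B) 1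
    simp only [skewLieProduct, jordanStarProduct, mul_one, one_mul, sub_eq_zero, cJ', mul_assoc,
      ← mul_add, star_mul, sJ] at e₁ e₂
    rw [← e₁, mul_neg, cJ] at e₂
    refine J_inj (two_cancel ?_)
    nth_rw 1 [e₂]
    simp
  have hS₃ : star S = -S := by
    have := hS₂ 1
    rw [mul_one, one_mul] at this
    exact eq_neg_of_add_eq_zero_right this
  have hS₄ (C : 𝒜) : C * S = S * C := by
    have := hS₂ C
    rw [hS₃, mul_neg, ← sub_eq_add_neg, sub_eq_zero] at this
    exact this.symm
  -- `Φ 1` is central and self-adjoint.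
  obtain ⟨U, hU⟩ : ∃ U, Φ 1 = U := ⟨_, rfl⟩
  have hU₁ (C : 𝒜) : U * C + star U * C - (C * U + C * star U) + 2 * (U * C - C * star U) = 0 := by
    have e := h 1 1 C
    have e0 (C : 𝒜) : skewLieProduct (jordanStarProduct (1 : 𝒜) 1) C = 0 := by
      simp [skewLieProduct, jordanStarProduct, mul_add, add_mul]
    rw [e0, e0, h.map_zero, add_zero, hU] at e
    rw [e]
    simp only [skewLieProduct, jordanStarProduct, star_add, star_one, star_star, mul_one, one_mul]
    noncomm_ring
  have hU₂ : star U = U := by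
    have := hU₁ 1
    simp only [mul_one, one_mul, sub_self, zero_add, two_mul] at this
    exact (sub_eq_zero.1 (two_cancel (this.trans (add_zero 0).symm))).symm
  have hU₃ (C : 𝒜) : C * U = U * C := by
    have := hU₁ C
    rw [hU₂] at this
    refine (sub_eq_zero.1 (two_cancel (two_cancel ?_))).symm
    rw [add_zero, add_zero, ← this]
    noncomm_ring
  have four_cancel {X Y : 𝒜} (e : 4 * X = 4 * Y) : X = Y := by
    refine two_cancel (two_cancel ?_)
    convert e using 1 <;> noncomm_ring
  have four (X : 𝒜) : Φ (4 * X) = 4 * Φ X := by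
    have : ∀ Y : 𝒜, 4 * Y = (Y + Y) + (Y + Y) := fun Y => by noncomm_ring
    rw [this, this, hadd, hadd]
  -- This comes from [1 • J, C]_* = 4JC. Evaluating at C = 1 will force U = 0, and then at C = J, S
  -- = 0.
  have hJ₁ (C : 𝒜) : Φ (J * C) = J * Φ C + J * (U * C) + S * C := by
    have e := h 1 J C
    have e0 (C : 𝒜) : skewLieProduct (jordanStarProduct (1 : 𝒜) J) C = 4 * (J * C) := by
      simp only [skewLieProduct, jordanStarProduct, star_add, star_one, mul_one, sJ,
        mul_add, add_mul, mul_neg, cJ]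
      noncomm_ring
    rw [e0, e0, hU, hS, four] at e
    apply four_cancel
    have cU := hU₃ C
    have cS := hS₄ C
    rw [e]
    simp only [skewLieProduct, jordanStarProduct, star_add, star_mul, star_one, mul_one, one_mul,
      sJ, hU₂, hS₃, mul_add, add_mul, mul_neg, cJ, cJ', cS, cU, mul_assoc]
    noncomm_ring
  have hU0 : U = 0 := by
    have e := hJ₁ 1
    rw [mul_one, hS, hU, mul_one, mul_one] at e
    refine J_inj (two_cancel ?_)
    rw [add_zero]
    exact (right_eq_add.1 e)
  have hS0 : S = 0 := by
    have e := hJ₁ J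
    rw [JJ, hneg, hU, hU0, hS, zero_mul, mul_zero, add_zero, neg_zero, cJ] at e
    exact J_inj (two_cancel (by rw [add_zero]; exact e.symm))
  have hJ₂ (C : 𝒜) : Φ (J * C) = J * Φ C := by simp [hJ₁ C, hU0, hS0]
  have hskew (X C : 𝒜) : Φ (skewLieProduct X C) =
      skewLieProduct (Φ X) C + skewLieProduct X (Φ C) := by
    have e := h 1 X C
    have e0 (X C : 𝒜) : skewLieProduct (jordanStarProduct (1 : 𝒜) X) C =
        skewLieProduct X C + skewLieProduct X C := by
      simp only [skewLieProduct, jordanStarProduct, star_add, star_one, one_mul, mul_one]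
      noncomm_ring
    have e1 : skewLieProduct (jordanStarProduct (0 : 𝒜) X) C = 0 := by
      simp [skewLieProduct, jordanStarProduct]
    rw [e0, e0, e0, hU, hU0, e1, hadd, zero_add] at e
    exact two_cancel (e.trans (by abel))
  have hstar (X : 𝒜) : Φ (star X) = star (Φ X) := by
    have e := hskew X 1
    simp only [skewLieProduct, mul_one, one_mul, hU, hU0, mul_zero, zero_mul, sub_zero, add_zero,
      hsub] at e
    exact sub_right_injective e
  refine ⟨hadd, fun X C => ?_, hstar⟩
  have e₁ := hskew X C
  -- Since [JX, C]_* = J(X • C), this yields the Leibniz rule for X • C.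
  have e₂ := hskew (J * X) C
  have e₃ : skewLieProduct (J * X) C = J * (X * C + C * star X) := by
    simp only [skewLieProduct, star_mul, sJ, mul_neg, mul_add, cJ, cJ', mul_assoc]
    abel
  have e₄ : skewLieProduct (Φ (J * X)) C + skewLieProduct (J * X) (Φ C) =
      J * (Φ X * C + C * star (Φ X) + X * Φ C + Φ C * star X) := by
    simp only [hJ₂, skewLieProduct, star_mul, sJ, mul_neg, mul_add, cJ, cJ', mul_assoc]
    abel
  rw [e₃, e₄, hJ₂, ← sub_eq_zero, ← mul_sub] at e₂
  have e₅ := sub_eq_zero.1 (J_inj e₂)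
  simp only [skewLieProduct, hsub, hadd] at e₁ e₅
  apply two_cancel
  calc Φ (X * C) + Φ (X * C)
      = (Φ (X * C) - Φ (C * star X)) + (Φ (X * C) + Φ (C * star X)) := by abel
    _ = _ := by rw [e₁, e₅]; abel

end IsMixedJordanTripleStarDerivation
end Algebra

/-! ### Primeness and nontrivial projections from the factor hypotheses. -/

namespace VonNeumannAlgebra

open ContinuousLinearMap

variable {H : Type*} [NormedAddCommGroup H] [InnerProductSpace ℂ H] [CompleteSpace H]
  (M : VonNeumannAlgebra H)

/-- A closed subspace invariant under the commutant is the range of a projection of `M`. -/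
theorem starProjection_mem (K : Submodule ℂ H) [K.HasOrthogonalProjection]
    (hK : ∀ y ∈ M.commutant, ∀ v ∈ K, y v ∈ K) : K.starProjection ∈ M := by
  rw [IsStarProjection.mem_iff isStarProjection_starProjection]
  intro y hy
  rw [Module.End.mem_invtSubmodule]
  intro v hv
  simp only [Submodule.range_starProjection, Submodule.mem_comap] at hv ⊢
  exact hK y hy v hv

/-- The annihilator condition expressing that a factor is a prime algebra. -/
theorem IsFactor.eq_zero_of_forall_mul_mul_eq_zero {M : VonNeumannAlgebra H} (hM : M.IsFactor)
    {X P : M.toStarSubalgebra} (hP : P ≠ 0) (h : ∀ A, X * A * P = 0) : X = 0 := by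
  -- This common kernel is invariant under both M and its commutant, so its projection is central,
  -- hence scalar. It contains the range of P ≠ 0, so the scalar is 1 and X kills all of H.
  let K : Submodule ℂ H := ⨅ A : M.toStarSubalgebra, ((X : H →L[ℂ] H) * (A : H →L[ℂ] H)).ker
  have memK (v : H) : v ∈ K ↔
      ∀ A : M.toStarSubalgebra, (X : H →L[ℂ] H) ((A : H →L[ℂ] H) v) = 0 := by
    simp [K, Submodule.mem_iInf]
  have hKc : IsClosed (K : Set H) := by
    simp only [K, Submodule.coe_iInf]
    exact isClosed_iInter fun A => ContinuousLinearMap.isClosed_ker _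
  have : CompleteSpace K := hKc.completeSpace_coe
  have h₁ : K.starProjection ∈ M := M.starProjection_mem K fun y hy v hv => by
    rw [memK] at hv ⊢
    intro A
    have c₁ := DFunLike.congr_fun (mem_commutant_iff.1 hy A A.2) v
    have c₂ := DFunLike.congr_fun (mem_commutant_iff.1 hy X X.2) ((A : H →L[ℂ] H) v)
    simp only [mul_apply_eq_comp] at c₁ c₂
    rw [c₁, c₂, hv, map_zero]
  have h₂ : K.starProjection ∈ M.commutant :=
    M.commutant.starProjection_mem K fun y hy v hv => by
      rw [commutant_commutant] at hy
      rw [memK] at hv ⊢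
      exact fun A => hv (A * (⟨y, hy⟩ : M.toStarSubalgebra))
  have hc : (⟨K.starProjection, h₁⟩ : M.toStarSubalgebra) ∈
      Subalgebra.center ℂ M.toStarSubalgebra :=
    Subalgebra.mem_center_iff.2 fun b => Subtype.ext (mem_commutant_iff.1 h₂ b b.2)
  rw [hM, Algebra.mem_bot] at hc
  obtain ⟨c, hc⟩ := hc
  have hc' (v : H) : c • v = K.starProjection v := by
    simpa [Algebra.algebraMap_eq_smul_one] using
      DFunLike.congr_fun (congrArg (Subtype.val : M.toStarSubalgebra → H →L[ℂ] H) hc) v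
  obtain ⟨v, hv⟩ : ∃ v, (P : H →L[ℂ] H) v ≠ 0 := by
    by_contra! h0
    exact hP (Subtype.ext (ContinuousLinearMap.ext h0))
  have hvK : (P : H →L[ℂ] H) v ∈ K := (memK _).2 fun A =>
    DFunLike.congr_fun (congrArg (Subtype.val : M.toStarSubalgebra → H →L[ℂ] H) (h A)) v
  have hc1 : c = 1 := by
    have := hc' ((P : H →L[ℂ] H) v)
    rw [Submodule.starProjection_eq_self_iff.2 hvK] at this
    exact smul_left_injective ℂ hv (by simpa using this)
  refine Subtype.ext (ContinuousLinearMap.ext fun w => ?_)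
  have hw : w ∈ K := by
    rw [← Submodule.starProjection_eq_self_iff, ← hc', hc1, one_smul]
  simpa using (memK w).1 hw 1

/-- A von Neumann algebra that is not one-dimensional contains a self-adjoint element that is not
a scalar. -/
theorem exists_isSelfAdjoint_not_scalar (hdim : 2 ≤ Module.rank ℂ M.toStarSubalgebra) :
    ∃ a ∈ M, IsSelfAdjoint a ∧ ∀ r : ℝ, a ≠ algebraMap ℝ (H →L[ℂ] H) r := by
  by_contra! hcon
  have hscalar (x : M.toStarSubalgebra) : ∃ c : ℂ, c • (1 : M.toStarSubalgebra) = x := by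
    obtain ⟨r, hr⟩ := hcon (realPart x : M.toStarSubalgebra) (realPart x).1.2
      (congrArg Subtype.val (realPart x).2)
    obtain ⟨s, hs⟩ := hcon (imaginaryPart x : M.toStarSubalgebra) (imaginaryPart x).1.2
      (congrArg Subtype.val (imaginaryPart x).2)
    refine ⟨r + Complex.I * s, ?_⟩
    have hx := congrArg (Subtype.val : M.toStarSubalgebra → H →L[ℂ] H)
      (realPart_add_I_smul_imaginaryPart x)
    apply Subtype.ext
    rw [← hx]
    simp only [AddMemClass.coe_add, SetLike.val_smul, hr, hs]
    ext v
    simp [Algebra.algebraMap_eq_smul_one, add_smul, mul_smul]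
  have : Module.rank ℂ M.toStarSubalgebra ≤ 1 := rank_le_one_iff.2 ⟨1, hscalar⟩
  have h12 := hdim.trans this
  norm_num at h12

/-- A von Neumann algebra that is not one-dimensional contains a nontrivial projection. -/
theorem exists_isStarProjection_ne (hdim : 2 ≤ Module.rank ℂ M.toStarSubalgebra) :
    ∃ P : M.toStarSubalgebra, IsStarProjection P ∧ P ≠ 0 ∧ P ≠ 1 := by
  obtain ⟨a, haM, ha, hns⟩ := M.exists_isSelfAdjoint_not_scalar hdim
  obtain ⟨s, hs, t, ht, hst⟩ : ∃ s ∈ spectrum ℝ a, ∃ t ∈ spectrum ℝ a, s < t := by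
    by_contra! hcon
    have hsub : (spectrum ℝ a).Subsingleton := fun x hx y hy =>
      le_antisymm (hcon y hy x hx) (hcon x hx y hy)
    rcases hsub.eq_empty_or_singleton with h0 | ⟨r, hr⟩
    -- Empty spectrum is the degenerate case H = 0, where any scalar would serve.
    · exact hns 0 (CFC.eq_algebraMap_of_spectrum_subset_singleton a 0 (by simp [h0]) ha)
    · exact hns r (CFC.eq_algebraMap_of_spectrum_subset_singleton a r hr.subset ha)
  obtain ⟨m, hsm, hmt⟩ := exists_between hst
  -- Both f(a) and g(a) are nonzero, while f(a)g(a) = 0. Hence ker f(a) contains the range of g(a)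
  -- but is not all of H, and its projection is nontrivial; continuous functional calculus suffices.
  let f : ℝ → ℝ := fun x => max (x - m) 0
  let g : ℝ → ℝ := fun x => max (m - x) 0
  have hf : Continuous f := by fun_prop
  have hg : Continuous g := by fun_prop
  have ne_zero {k : ℝ → ℝ} (hk : Continuous k) {x : ℝ} (hx : x ∈ spectrum ℝ a) (h0 : k x ≠ 0) :
      cfc k a ≠ 0 := fun h => by
    have hmem : k x ∈ spectrum ℝ (cfc k a) := by
      rw [cfc_map_spectrum k a ha hk.continuousOn]
      exact ⟨x, hx, rfl⟩
    rw [h] at hmem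
    have : Nontrivial (H →L[ℂ] H) := by
      by_contra hn
      rw [not_nontrivial_iff_subsingleton] at hn
      exact hns 0 (Subsingleton.elim _ _)
    rw [spectrum.zero_eq] at hmem
    exact h0 hmem
  have hf0 : cfc f a ≠ 0 := ne_zero hf ht (by simp [f, hmt])
  have hg0 : cfc g a ≠ 0 := ne_zero hg hs (by simp [g, hsm])
  have hfg : cfc f a * cfc g a = 0 := by
    rw [← cfc_mul f g a hf.continuousOn hg.continuousOn]
    have : (fun x => f x * g x) = fun _ => 0 := by
      ext x
      rcases le_total x m with hx | hx
      · simp [f, hx]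
      · simp [g, hx]
    rw [this, cfc_const_zero]
  let K : Submodule ℂ H := (cfc f a).ker
  have : CompleteSpace K := (ContinuousLinearMap.isClosed_ker (cfc f a)).completeSpace_coe
  have hK : K.starProjection ∈ M := M.starProjection_mem K fun y hy v hv => by
    have hc : Commute (cfc f a) y :=
      ha.commute_cfc (mem_commutant_iff.1 hy a haM) f
    have := DFunLike.congr_fun hc.eq v
    have hv' : cfc f a v = 0 := hv
    show cfc f a (y v) = 0
    simpa [hv'] using this
  refine ⟨⟨K.starProjection, hK⟩, ⟨?_, ?_⟩, fun h => hg0 ?_, fun h => hf0 ?_⟩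
  · exact Subtype.ext (isStarProjection_starProjection (U := K)).isIdempotentElem
  · exact Subtype.ext (isStarProjection_starProjection (U := K)).isSelfAdjoint
  · have h' : K.starProjection = 0 := congrArg Subtype.val h
    ext v
    have hv : cfc g a v ∈ K := DFunLike.congr_fun hfg v
    rw [← Submodule.starProjection_eq_self_iff, h'] at hv
    simpa using hv.symm
  · have h' : K.starProjection = 1 := congrArg Subtype.val h
    ext v
    have hv : v ∈ K := by rw [← Submodule.starProjection_eq_self_iff, h']; rfl
    exact hv

end VonNeumannAlgebra

theorem corollary3p3 {H : Type*} [NormedAddCommGroup H] [InnerProductSpace ℂ H]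
    [CompleteSpace H] (M : VonNeumannAlgebra H) (hM : M.IsFactor)
    (hdim : 2 ≤ Module.rank ℂ M.toStarSubalgebra)
    (Φ : M.toStarSubalgebra → M.toStarSubalgebra) :
    IsMixedJordanTripleStarDerivation Φ ↔ IsAdditiveStarDerivation Φ := by
  refine ⟨fun h => ?_, fun h => h.isMixedJordanTripleStarDerivation⟩
  obtain ⟨P, hP, hP0, hP1⟩ := M.exists_isStarProjection_ne hdim
  exact h.isAdditiveStarDerivation_of_map_add (h.map_add hP
    (fun _ => hM.eq_zero_of_forall_mul_mul_eq_zero hP0)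
    (fun _ => hM.eq_zero_of_forall_mul_mul_eq_zero (sub_ne_zero.2 hP1.symm)))
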